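/- Tile $\mathbb{R}^2$ by the unit squares $S_z$, $z\in\mathbb{Z}^2$, where $S_z$ has centre $z$ and sides parallel to the axes, and let $G$ be the graph whose vertices are the corners and whose edges are the sides of these squares. A cycle in $G$ is a closed path that does not intersect itself; cycles are identified with their edge sets. A cycle divides the plane into two regions; the bounded one is its interior and the unbounded one its exterior. An edge of $G$ is contained in the interior (respectively, lies in the exterior) of a cycle if both of the squares having it as a side lie, up to their boundaries, in the interior (respectively, exterior) of the cycle. Let $C$ and $D$ be cycles in $G$ that have more than one vertex in common. There exists a unique cycle $E$ consisting only of edges of $C$ and $D$ with the following properties: (i) The interior of $E$ contains the interiors of both $C$ and $D$. (ii) If an edge $e$ belongs to $C$ or $D$, then either $e$ belongs to $E$ or $e$ is contained in the interior of $E$. Moreover, if $D$ contains at least one edge in the exterior of $C$, then the cycle $E$ also contains an edge of $D$ that lies in the exterior of $C$. -/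

import Mathlib

namespace SquareGrid

/-- The graph on `ℤ × ℤ` in which two vertices are adjacent when they differ by one in exactly
one coordinate and agree in the other. -/
def gridGraph : SimpleGraph (ℤ × ℤ) where
  Adj u v := (u.1 = v.1 ∧ |u.2 - v.2| = 1) ∨ (u.2 = v.2 ∧ |u.1 - v.1| = 1)
  symm := ⟨fun u v h => by
    rcases h with ⟨h, h'⟩ | ⟨h, h'⟩
    · exact Or.inl ⟨h.symm, by rw [abs_sub_comm]; exact h'⟩
    · exact Or.inr ⟨h.symm, by rw [abs_sub_comm]; exact h'⟩⟩
  loopless := ⟨fun u h => by simp at h⟩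

/-- The position in the plane of a vertex of the grid. -/
noncomputable def point (v : ℤ × ℤ) : ℝ × ℝ := ((v.1 : ℝ) + 1 / 2, (v.2 : ℝ) + 1 / 2)

/-- The (open) unit square of the tiling with centre `z`. -/
def square (z : ℤ × ℤ) : Set (ℝ × ℝ) :=
  Set.Ioo ((z.1 : ℝ) - 1 / 2) ((z.1 : ℝ) + 1 / 2) ×ˢ
    Set.Ioo ((z.2 : ℝ) - 1 / 2) ((z.2 : ℝ) + 1 / 2)

/-- The four corners of the square with centre `z`, as vertices of the grid. -/
def corners (z : ℤ × ℤ) : Set (ℤ × ℤ) :=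
  {z, (z.1 - 1, z.2), (z.1, z.2 - 1), (z.1 - 1, z.2 - 1)}

/-- `e` is one of the four edges of the square with centre `z`. -/
def IsEdgeOfSquare (e : Sym2 (ℤ × ℤ)) (z : ℤ × ℤ) : Prop :=
  e ∈ gridGraph.edgeSet ∧ ∀ v ∈ e, v ∈ corners z

/-- `C` is the set of edges of a (self-avoiding) cycle of the grid. -/
def IsCycle (C : Set (Sym2 (ℤ × ℤ))) : Prop :=
  ∃ (v : ℤ × ℤ) (p : gridGraph.Walk v v), p.IsCycle ∧ C = {e | e ∈ p.edges}

/-- The endvertices of the edges in `C`. -/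
def vertices (C : Set (Sym2 (ℤ × ℤ))) : Set (ℤ × ℤ) :=
  {v | ∃ e ∈ C, v ∈ e}

/-- The closed subset of the plane drawn by the edges in `C`. -/
def trace (C : Set (Sym2 (ℤ × ℤ))) : Set (ℝ × ℝ) :=
  {x | ∃ u v : ℤ × ℤ, s(u, v) ∈ C ∧ x ∈ segment ℝ (point u) (point v)}

/-- The bounded region of the complement of `C` in the plane: the points off `C` whose connected
component in the complement of `C` is bounded. -/
def inside (C : Set (Sym2 (ℤ × ℤ))) : Set (ℝ × ℝ) :=
  {x | x ∉ trace C ∧ Bornology.IsBounded (connectedComponentIn (trace C)ᶜ x)}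

/-- The unbounded region of the complement of `C` in the plane: the points off `C` whose connected
component in the complement of `C` is unbounded. -/
def outside (C : Set (Sym2 (ℤ × ℤ))) : Set (ℝ × ℝ) :=
  {x | x ∉ trace C ∧ ¬ Bornology.IsBounded (connectedComponentIn (trace C)ᶜ x)}

/-- The edge `e` is contained in the interior of `C`: both squares having `e` as an edge lie in the
interior of `C`. -/
def EdgeInside (e : Sym2 (ℤ × ℤ)) (C : Set (Sym2 (ℤ × ℤ))) : Prop :=
  e ∈ gridGraph.edgeSet ∧ ∀ z, IsEdgeOfSquare e z → square z ⊆ inside C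

/-- The edge `e` lies in the exterior of `C`: both squares having `e` as an edge lie in the
exterior of `C`. -/
def EdgeOutside (e : Sym2 (ℤ × ℤ)) (C : Set (Sym2 (ℤ × ℤ))) : Prop :=
  e ∈ gridGraph.edgeSet ∧ ∀ z, IsEdgeOfSquare e z → square z ⊆ outside C

/-- `E` is a cycle consisting only of edges of `C` and `D`, the interior of `E` contains the
interiors of `C` and of `D`, and every edge of `C` or `D` belongs to `E` or is contained in the
interior of `E`. -/
structure IsMerger (C D E : Set (Sym2 (ℤ × ℤ))) : Prop where
  isCycle : IsCycle E
  subset_union : E ⊆ C ∪ D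
  inside_left : inside C ⊆ inside E
  inside_right : inside D ⊆ inside E
  edge_mem_or_inside : ∀ e ∈ C ∪ D, e ∈ E ∨ EdgeInside e E

end SquareGrid

/-! The argument is parity modulo two. Finite even edge sets are exactly the boundaries of finite
sets of squares (`IsEven.exists_boundary_eq`), the square set being unique (`boundary_injOn`), and a
cycle is a minimal nonempty even set (`IsCycle.eq_of_subset`). Hence a cycle is `boundary A` for one
finite `A`, and `mem_inside_iff` identifies its topological interior with `A`. Everything else is
about sets of squares.

Let `B` be the largest finite set of squares with boundary in `C ∪ D`; then `E = boundary B`. It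
contains the interiors of `C` and `D` by maximality, and (ii) follows. To see that it is a cycle: an
edge of `boundary B` has only one square in `B`, so cycles in `boundary B` sharing an edge have
meeting interiors, and minimality makes them equal. Likewise the edges of `C` in `boundary B` lie in
one cycle `F`, those of `D` in one cycle `F'`. If `F = F'`, this is `boundary B`. Otherwise `F` and
`F'` are disjoint, so `F = C` and `F' = D`; two common vertices then yield a third cycle sharing an
edge with `C`, which is impossible.

Uniqueness: if `boundary Y` is another merger, (ii) puts the boundary of `B \ Y` into that of `Y`,
and minimality forces `B \ Y` to be empty. -/

namespace SquareGrid

/-! ### Edges, squares and boundaries of sets of squares. -/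

/-- The edge of the grid between the squares with centres `(x, y)` and `(x, y + 1)`. -/
def hEdge (x y : ℤ) : Sym2 (ℤ × ℤ) := s((x - 1, y), (x, y))

/-- The edge of the grid between the squares with centres `(x, y)` and `(x + 1, y)`. -/
def vEdge (x y : ℤ) : Sym2 (ℤ × ℤ) := s((x, y - 1), (x, y))

theorem hEdge_inj {x y x' y' : ℤ} : hEdge x y = hEdge x' y' ↔ x = x' ∧ y = y' := by
  simp only [hEdge, Sym2.eq_iff, Prod.mk.injEq]
  omega

theorem vEdge_inj {x y x' y' : ℤ} : vEdge x y = vEdge x' y' ↔ x = x' ∧ y = y' := by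
  simp only [vEdge, Sym2.eq_iff, Prod.mk.injEq]
  omega

theorem hEdge_ne_vEdge (x y x' y' : ℤ) : hEdge x y ≠ vEdge x' y' := by
  simp only [hEdge, vEdge, ne_eq, Sym2.eq_iff, Prod.mk.injEq]
  omega

theorem adj_iff {u v : ℤ × ℤ} : gridGraph.Adj u v ↔
    (u.1 = v.1 ∧ (v.2 = u.2 + 1 ∨ u.2 = v.2 + 1)) ∨
      (u.2 = v.2 ∧ (v.1 = u.1 + 1 ∨ u.1 = v.1 + 1)) := by
  simp only [gridGraph, abs_eq (zero_le_one (α := ℤ))]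
  omega

theorem hEdge_mem (x y : ℤ) : hEdge x y ∈ gridGraph.edgeSet := by
  rw [hEdge, SimpleGraph.mem_edgeSet, adj_iff]
  simp

theorem vEdge_mem (x y : ℤ) : vEdge x y ∈ gridGraph.edgeSet := by
  rw [vEdge, SimpleGraph.mem_edgeSet, adj_iff]
  simp

theorem edge_eq_of_adj {u v : ℤ × ℤ} (h : gridGraph.Adj u v) :
    (∃ x y, s(u, v) = hEdge x y) ∨ ∃ x y, s(u, v) = vEdge x y := by
  obtain ⟨a, b⟩ := u
  obtain ⟨c, d⟩ := v
  rw [adj_iff] at h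
  simp only [hEdge, vEdge, Sym2.eq_iff, Prod.mk.injEq]
  rcases h with ⟨h, h' | h'⟩ | ⟨h, h' | h'⟩
  · exact Or.inr ⟨a, d, by omega⟩
  · exact Or.inr ⟨a, b, by omega⟩
  · exact Or.inl ⟨c, b, by omega⟩
  · exact Or.inl ⟨a, b, by omega⟩

theorem edge_cases {e : Sym2 (ℤ × ℤ)} (h : e ∈ gridGraph.edgeSet) :
    (∃ x y, e = hEdge x y) ∨ ∃ x y, e = vEdge x y := by
  induction e with
  | _ u v => exact edge_eq_of_adj h

theorem isEdgeOfSquare_hEdge {x y : ℤ} {z : ℤ × ℤ} :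
    IsEdgeOfSquare (hEdge x y) z ↔ z = (x, y) ∨ z = (x, y + 1) := by
  obtain ⟨a, b⟩ := z
  simp only [IsEdgeOfSquare, hEdge_mem, true_and]
  simp only [hEdge, Sym2.mem_iff, forall_eq_or_imp, forall_eq, corners, Set.mem_insert_iff,
    Set.mem_singleton_iff, Prod.mk.injEq]
  omega

theorem isEdgeOfSquare_vEdge {x y : ℤ} {z : ℤ × ℤ} :
    IsEdgeOfSquare (vEdge x y) z ↔ z = (x, y) ∨ z = (x + 1, y) := by
  obtain ⟨a, b⟩ := z
  simp only [IsEdgeOfSquare, vEdge_mem, true_and]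
  simp only [vEdge, Sym2.mem_iff, forall_eq_or_imp, forall_eq, corners, Set.mem_insert_iff,
    Set.mem_singleton_iff, Prod.mk.injEq]
  omega

/-- The edges of the grid with exactly one of their two squares in `A`. -/
def boundary (A : Set (ℤ × ℤ)) : Set (Sym2 (ℤ × ℤ)) :=
  {e | ∃ z ∈ A, ∃ z' ∉ A, IsEdgeOfSquare e z ∧ IsEdgeOfSquare e z'}

theorem boundary_subset_edgeSet (A : Set (ℤ × ℤ)) : boundary A ⊆ gridGraph.edgeSet :=
  fun _ ⟨_, _, _, _, h, _⟩ => h.1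

theorem hEdge_mem_boundary {A : Set (ℤ × ℤ)} {x y : ℤ} :
    hEdge x y ∈ boundary A ↔ ¬ ((x, y) ∈ A ↔ (x, y + 1) ∈ A) := by
  simp only [boundary, Set.mem_ofPred_eq, isEdgeOfSquare_hEdge]
  constructor
  · rintro ⟨z, hz, z', hz', rfl | rfl, rfl | rfl⟩ <;> tauto
  · intro h
    by_cases h1 : (x, y) ∈ A
    · exact ⟨_, h1, (x, y + 1), by tauto, by simp⟩
    · exact ⟨(x, y + 1), by tauto, _, h1, by simp⟩

theorem vEdge_mem_boundary {A : Set (ℤ × ℤ)} {x y : ℤ} :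
    vEdge x y ∈ boundary A ↔ ¬ ((x, y) ∈ A ↔ (x + 1, y) ∈ A) := by
  simp only [boundary, Set.mem_ofPred_eq, isEdgeOfSquare_vEdge]
  constructor
  · rintro ⟨z, hz, z', hz', rfl | rfl, rfl | rfl⟩ <;> tauto
  · intro h
    by_cases h1 : (x, y) ∈ A
    · exact ⟨_, h1, (x + 1, y), by tauto, by simp⟩
    · exact ⟨(x + 1, y), by tauto, _, h1, by simp⟩

/-- An edge in the boundary of `A` has exactly one square in `A`. -/
theorem eq_of_mem_boundary {A : Set (ℤ × ℤ)} {e : Sym2 (ℤ × ℤ)} (he : e ∈ boundary A)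
    {z z' : ℤ × ℤ} (hz : IsEdgeOfSquare e z) (hz' : IsEdgeOfSquare e z')
    (h : z ∈ A ↔ z' ∈ A) : z = z' := by
  rcases edge_cases hz.1 with ⟨x, y, rfl⟩ | ⟨x, y, rfl⟩
  · rw [hEdge_mem_boundary] at he
    rw [isEdgeOfSquare_hEdge] at hz hz'
    rcases hz with rfl | rfl <;> rcases hz' with rfl | rfl <;> tauto
  · rw [vEdge_mem_boundary] at he
    rw [isEdgeOfSquare_vEdge] at hz hz'
    rcases hz with rfl | rfl <;> rcases hz' with rfl | rfl <;> tauto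

/-! ### Degrees modulo two and even edge sets. -/

open Classical in
/-- The indicator function of a set, modulo two. -/
noncomputable def ind {α : Type*} (C : Set α) (e : α) : ZMod 2 := if e ∈ C then 1 else 0

theorem ind_of_mem {α : Type*} {C : Set α} {e : α} (h : e ∈ C) : ind C e = 1 := if_pos h

theorem ind_of_notMem {α : Type*} {C : Set α} {e : α} (h : e ∉ C) : ind C e = 0 := if_neg h

theorem ind_eq_one {α : Type*} {C : Set α} {e : α} : ind C e = 1 ↔ e ∈ C := by
  unfold ind; split_ifs <;> simp_all

theorem ind_add_ind {α β : Type*} {C : Set α} {D F : Set β} {e : α} {f g : β}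
    (h : e ∈ C ↔ ¬ (f ∈ D ↔ g ∈ F)) : ind C e = ind D f + ind F g := by
  unfold ind
  split_ifs <;> first | decide | tauto

theorem ind_union {α : Type*} {C D : Set α} (h : Disjoint C D) (e : α) :
    ind (C ∪ D) e = ind C e + ind D e :=
  ind_add_ind <| by
    have : e ∈ C → e ∉ D := fun hC => Set.disjoint_left.1 h hC
    simp only [Set.mem_union]; tauto

theorem add_self_zmod_two (a : ZMod 2) : a + a = 0 := CharTwo.add_self_eq_zero a

/-- The number of edges of `C` at the vertex `w`, modulo two. -/
noncomputable def degree (C : Set (Sym2 (ℤ × ℤ))) (w : ℤ × ℤ) : ZMod 2 :=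
  ind C (hEdge w.1 w.2) + ind C (hEdge (w.1 + 1) w.2) +
    (ind C (vEdge w.1 w.2) + ind C (vEdge w.1 (w.2 + 1)))

theorem degree_union {C D : Set (Sym2 (ℤ × ℤ))} (h : Disjoint C D) (w : ℤ × ℤ) :
    degree (C ∪ D) w = degree C w + degree D w := by
  simp only [degree, ind_union h]; ring

theorem degree_diff {C D : Set (Sym2 (ℤ × ℤ))} (h : D ⊆ C) (w : ℤ × ℤ) :
    degree (C \ D) w = degree C w + degree D w := by
  have := degree_union (C := C \ D) (D := D) Set.disjoint_sdiff_left w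
  rw [Set.sdiff_union_of_subset h] at this
  rw [this, add_assoc, add_self_zmod_two, add_zero]

theorem degree_empty (w : ℤ × ℤ) : degree ∅ w = 0 := by simp [degree, ind]

theorem degree_eq_zero_of_forall_notMem {C : Set (Sym2 (ℤ × ℤ))} {w : ℤ × ℤ}
    (h : ∀ e ∈ C, w ∉ e) : degree C w = 0 := by
  obtain ⟨a, b⟩ := w
  have h1 : hEdge a b ∉ C := fun hh => h _ hh (by simp [hEdge])
  have h2 : hEdge (a + 1) b ∉ C := fun hh => h _ hh (by simp [hEdge])
  have h3 : vEdge a b ∉ C := fun hh => h _ hh (by simp [vEdge])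
  have h4 : vEdge a (b + 1) ∉ C := fun hh => h _ hh (by simp [vEdge])
  simp [degree, ind_of_notMem, h1, h2, h3, h4]

theorem exists_mem_of_degree_ne_zero {C : Set (Sym2 (ℤ × ℤ))} {w : ℤ × ℤ}
    (h : degree C w ≠ 0) : ∃ e ∈ C, w ∈ e := by
  by_contra! h'
  exact h (degree_eq_zero_of_forall_notMem h')

theorem degree_singleton {u v : ℤ × ℤ} (h : gridGraph.Adj u v) (w : ℤ × ℤ) :
    degree {s(u, v)} w = ind {u} w + ind {v} w := by
  obtain ⟨a, b⟩ := w
  rcases edge_eq_of_adj h with ⟨x, y, e⟩ | ⟨x, y, e⟩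
  · have key : (u = (x - 1, y) ∧ v = (x, y)) ∨ (u = (x, y) ∧ v = (x - 1, y)) := by
      simpa [hEdge, Sym2.eq_iff] using e
    have : ind {u} (a, b) + ind {v} (a, b) =
        ind {(x - 1, y)} (a, b) + ind {(x, y)} (a, b) := by
      rcases key with ⟨rfl, rfl⟩ | ⟨rfl, rfl⟩
      · rfl
      · exact add_comm _ _
    rw [this, e]
    simp only [degree, ind, Set.mem_singleton_iff, hEdge_inj, (hEdge_ne_vEdge _ _ _ _).symm,
      Prod.mk.injEq, if_false, add_zero]
    rw [add_comm]
    congr 1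
    simp only [eq_sub_iff_add_eq]
  · have key : (u = (x, y - 1) ∧ v = (x, y)) ∨ (u = (x, y) ∧ v = (x, y - 1)) := by
      simpa [vEdge, Sym2.eq_iff] using e
    have : ind {u} (a, b) + ind {v} (a, b) =
        ind {(x, y - 1)} (a, b) + ind {(x, y)} (a, b) := by
      rcases key with ⟨rfl, rfl⟩ | ⟨rfl, rfl⟩
      · rfl
      · exact add_comm _ _
    rw [this, e]
    simp only [degree, ind, Set.mem_singleton_iff, vEdge_inj, hEdge_ne_vEdge _ _ _ _,
      Prod.mk.injEq, if_false, zero_add]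
    rw [add_comm]
    congr 1
    simp only [eq_sub_iff_add_eq]

/-- Every vertex of the grid has an even number of edges in `C`. -/
def IsEven (C : Set (Sym2 (ℤ × ℤ))) : Prop := ∀ w, degree C w = 0

theorem IsEven.diff {C D : Set (Sym2 (ℤ × ℤ))} (hC : IsEven C) (hD : IsEven D)
    (h : D ⊆ C) : IsEven (C \ D) := fun w => by
  rw [degree_diff h, hC, hD, add_zero]

theorem ind_boundary_hEdge (A : Set (ℤ × ℤ)) (x y : ℤ) :
    ind (boundary A) (hEdge x y) = ind A (x, y) + ind A (x, y + 1) :=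
  ind_add_ind hEdge_mem_boundary

theorem ind_boundary_vEdge (A : Set (ℤ × ℤ)) (x y : ℤ) :
    ind (boundary A) (vEdge x y) = ind A (x, y) + ind A (x + 1, y) :=
  ind_add_ind vEdge_mem_boundary

/-- Each of the four squares around `w` is counted by exactly two of the four edges at `w`. -/
theorem isEven_boundary (A : Set (ℤ × ℤ)) : IsEven (boundary A) := fun w => by
  simp only [degree, ind_boundary_hEdge, ind_boundary_vEdge]
  generalize ind A (w.1, w.2) = a
  generalize ind A (w.1, w.2 + 1) = b
  generalize ind A (w.1 + 1, w.2) = c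
  generalize ind A (w.1 + 1, w.2 + 1) = d
  revert a b c d
  decide

/-- Crossing a vertical edge changes membership in both sets or in neither. Far to the right both
sets are absent, so their agreement there propagates back along the row. -/
theorem boundary_injOn : Set.InjOn boundary {A : Set (ℤ × ℤ) | A.Finite} := by
  intro A hA A' hA' h
  ext ⟨x, y⟩
  obtain ⟨n, hn⟩ : ∃ n : ℕ, (x + n, y) ∉ A ∪ A' := by
    by_contra! hc
    refine Set.infinite_of_injective_forall_mem (f := fun n : ℕ => (x + n, y)) ?_ hc
      (hA.union hA')
    intro a b hab
    simpa using hab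
  have key : ∀ n : ℕ, ((x, y) ∈ A ↔ (x, y) ∈ A') ↔ ((x + n, y) ∈ A ↔ (x + n, y) ∈ A') := by
    intro n
    induction n with
    | zero => simp
    | succ n ih =>
      have h1 := vEdge_mem_boundary (A := A) (x := x + n) (y := y)
      have h2 := vEdge_mem_boundary (A := A') (x := x + n) (y := y)
      rw [h] at h1
      push_cast
      rw [← add_assoc]
      tauto
  rw [Set.mem_union] at hn
  have := key n
  tauto

theorem boundary_empty : boundary ∅ = ∅ := by
  ext e; simp [boundary]

theorem boundary_nonempty {A : Set (ℤ × ℤ)} (hA : A.Finite) (h : A.Nonempty) :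
    (boundary A).Nonempty := by
  by_contra hc
  rw [Set.not_nonempty_iff_eq_empty, ← boundary_empty] at hc
  exact h.ne_empty (boundary_injOn hA Set.finite_empty hc)

theorem boundary_inter_subset (A A' : Set (ℤ × ℤ)) :
    boundary (A ∩ A') ⊆ boundary A ∪ boundary A' := by
  rintro e ⟨z, ⟨h1, h2⟩, z', h3, hz, hz'⟩
  by_cases h : z' ∈ A
  · exact Or.inr ⟨z, h2, z', fun h' => h3 ⟨h, h'⟩, hz, hz'⟩
  · exact Or.inl ⟨z, h1, z', h, hz, hz'⟩

theorem boundary_diff_subset (A A' : Set (ℤ × ℤ)) :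
    boundary (A \ A') ⊆ boundary A ∪ boundary A' := by
  rintro e ⟨z, ⟨h1, h2⟩, z', h3, hz, hz'⟩
  by_cases h : z' ∈ A
  · exact Or.inr ⟨z', by_contra fun h' => h3 ⟨h, h'⟩, z, h2, hz', hz⟩
  · exact Or.inl ⟨z, h1, z', h, hz, hz'⟩

theorem boundary_sUnion_subset {S : Set (Set (ℤ × ℤ))} {C : Set (Sym2 (ℤ × ℤ))}
    (h : ∀ A ∈ S, boundary A ⊆ C) : boundary (⋃₀ S) ⊆ C := by
  rintro e ⟨z, ⟨A, hA, hz⟩, z', hz', h1, h2⟩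
  exact h A hA ⟨z, hz, z', fun h' => hz' ⟨A, hA, h'⟩, h1, h2⟩

theorem exists_bound {C : Set (Sym2 (ℤ × ℤ))} (hC : C.Finite) :
    ∃ N : ℤ, ∀ x y, (hEdge x y ∈ C ∨ vEdge x y ∈ C) → -N ≤ x ∧ x ≤ N ∧ -N ≤ y ∧ y ≤ N := by
  have fin : ({p : ℤ × ℤ | hEdge p.1 p.2 ∈ C} ∪ {p : ℤ × ℤ | vEdge p.1 p.2 ∈ C}).Finite := by
    refine Set.Finite.union (hC.preimage (f := fun p : ℤ × ℤ => hEdge p.1 p.2) ?_)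
      (hC.preimage (f := fun p : ℤ × ℤ => vEdge p.1 p.2) ?_)
    · exact fun p _ q _ h => Prod.ext_iff.2 (hEdge_inj.1 h)
    · exact fun p _ q _ h => Prod.ext_iff.2 (vEdge_inj.1 h)
  obtain ⟨a, ha⟩ := fin.bddAbove
  obtain ⟨b, hb⟩ := fin.bddBelow
  refine ⟨|a.1| + |a.2| + |b.1| + |b.2|, fun x y h => ?_⟩
  have h1 := Prod.le_def.1 (ha (show (x, y) ∈ _ from h))
  have h2 := Prod.le_def.1 (hb (show (x, y) ∈ _ from h))
  simp only at h1 h2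
  have := neg_abs_le b.1
  have := neg_abs_le b.2
  have := le_abs_self a.1
  have := le_abs_self a.2
  have := abs_nonneg a.1
  have := abs_nonneg a.2
  have := abs_nonneg b.1
  have := abs_nonneg b.2
  omega

theorem int_decreasing_induction {p : ℤ → Prop} (N : ℤ) (h : ∀ x, N < x → p x)
    (step : ∀ x, p (x + 1) → p x) (x : ℤ) : p x := by
  rcases lt_or_ge N x with hx | hx
  · exact h x hx
  · refine Int.leInductionDown (m := N + 1) (motive := fun k _ => p k) (h _ (by omega)) ?_ x
      (by omega)
    intro n _ hn
    exact step _ (by simpa using hn)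

/-- A finite even set of edges is the boundary of a finite set of squares. -/
theorem IsEven.exists_boundary_eq {C : Set (Sym2 (ℤ × ℤ))} (hC : IsEven C) (hfin : C.Finite)
    (hsub : C ⊆ gridGraph.edgeSet) : ∃ A : Set (ℤ × ℤ), A.Finite ∧ boundary A = C := by
  obtain ⟨N, hN⟩ := exists_bound hfin
  have hh : ∀ x y, (x < -N ∨ N < x ∨ y < -N ∨ N < y) → ind C (hEdge x y) = 0 := fun x y h =>
    ind_of_notMem fun h' => by have := hN x y (Or.inl h'); omega
  have hv : ∀ x y, (x < -N ∨ N < x ∨ y < -N ∨ N < y) → ind C (vEdge x y) = 0 := fun x y h =>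
    ind_of_notMem fun h' => by have := hN x y (Or.inr h'); omega
  -- Ray-crossing parity: the number of edges of `C` met by the ray going right from the centre of
  -- the square `(x, y)`.
  let f : ℤ → ℤ → ZMod 2 := fun x y => ∑ i ∈ Finset.Ico x (N + 1), ind C (vEdge i y)
  have f_right : ∀ x y, N < x → f x y = 0 := fun x y h => by
    simp only [f]
    rw [Finset.Ico_eq_empty (by omega), Finset.sum_empty]
  have f_vEdge : ∀ x y, f x y + f (x + 1) y = ind C (vEdge x y) := by
    intro x y
    rcases lt_or_ge N x with h | h
    · rw [f_right x y h, f_right (x + 1) y (by omega), hv x y (by omega), add_zero]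
    · have : f x y = ind C (vEdge x y) + f (x + 1) y := by
        simp only [f]
        rw [← Finset.insert_Ico_add_one_left_eq_Ico (by omega : x < N + 1),
          Finset.sum_insert (by simp)]
      rw [this, add_assoc, add_self_zmod_two, add_zero]
  -- Evenness at the vertex `(x, y)` transfers the relation across `hEdge (x + 1) y` to `hEdge x y`;
  -- it is trivial to the right of `C`.
  have f_hEdge : ∀ y x, f x y + f x (y + 1) = ind C (hEdge x y) := by
    intro y
    refine int_decreasing_induction N ?_ ?_
    · intro x h
      rw [f_right x y h, f_right x _ h, hh x y (by omega), add_zero]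
    · intro x ih
      have h1 := f_vEdge x y
      have h2 := f_vEdge x (y + 1)
      have h3 := hC (x, y)
      simp only [degree] at h3
      rw [← h1, ← h2, ← ih] at h3
      revert h3
      generalize f x y = a
      generalize f x (y + 1) = b
      generalize f (x + 1) y = c
      generalize f (x + 1) (y + 1) = d
      generalize ind C (hEdge x y) = t
      revert a b c d t
      decide
  have f_out : ∀ x y, (y < -N ∨ N < y) → f x y = 0 := fun x y h =>
    Finset.sum_eq_zero fun i _ => hv i y (by omega)
  -- Left of `C` there are no horizontal edges to cross, so `f` is constant on columns, and it
  -- vanishes above `C`.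
  have f_left : ∀ x, x < -N → ∀ y, f x y = 0 := by
    intro x hx
    refine int_decreasing_induction N (fun y hy => f_out x y (Or.inr hy)) ?_
    intro y ih
    have := f_hEdge y x
    rwa [ih, hh x y (by omega), add_zero] at this
  refine ⟨{z | f z.1 z.2 = 1}, ?_, ?_⟩
  · refine ((Set.finite_Icc (-N) N).prod (Set.finite_Icc (-N) N)).subset ?_
    rintro ⟨x, y⟩ hz
    simp only [Set.mem_ofPred_eq] at hz
    by_contra hc
    simp only [Set.mem_prod, Set.mem_Icc] at hc
    have : f x y = 0 := by
      by_cases h1 : x < -N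
      · exact f_left x h1 y
      by_cases h2 : N < x
      · exact f_right x y h2
      · exact f_out x y (by omega)
    rw [this] at hz
    exact zero_ne_one hz
  · have aux : ∀ a b : ZMod 2, ¬ (a = 1 ↔ b = 1) ↔ a + b = 1 := by decide
    ext e
    constructor
    · intro he
      rcases edge_cases (boundary_subset_edgeSet _ he) with ⟨x, y, rfl⟩ | ⟨x, y, rfl⟩
      · rw [hEdge_mem_boundary] at he
        simp only [Set.mem_ofPred_eq] at he
        rwa [aux, f_hEdge, ind_eq_one] at he
      · rw [vEdge_mem_boundary] at he
        simp only [Set.mem_ofPred_eq] at he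
        rwa [aux, f_vEdge, ind_eq_one] at he
    · intro he
      rcases edge_cases (hsub he) with ⟨x, y, rfl⟩ | ⟨x, y, rfl⟩
      · rw [hEdge_mem_boundary]
        simp only [Set.mem_ofPred_eq]
        rwa [aux, f_hEdge, ind_eq_one]
      · rw [vEdge_mem_boundary]
        simp only [Set.mem_ofPred_eq]
        rwa [aux, f_vEdge, ind_eq_one]

/-! ### Walks, cycles and minimality of cycles among even sets. -/

open SimpleGraph

/-- The set of edges traversed by a walk of the grid. -/
def edgesOf {u v : ℤ × ℤ} (p : gridGraph.Walk u v) : Set (Sym2 (ℤ × ℤ)) := {e | e ∈ p.edges}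

theorem edgesOf_cons {u v w : ℤ × ℤ} (h : gridGraph.Adj u v) (p : gridGraph.Walk v w) :
    edgesOf (.cons h p) = {s(u, v)} ∪ edgesOf p := by
  ext e; simp [edgesOf]

theorem edgesOf_subset {u v : ℤ × ℤ} (p : gridGraph.Walk u v) :
    edgesOf p ⊆ gridGraph.edgeSet := fun _ h => p.edges_subset_edgeSet h

theorem finite_edgesOf {u v : ℤ × ℤ} (p : gridGraph.Walk u v) : (edgesOf p).Finite :=
  List.finite_toSet p.edges

/-- The endpoint contributions of successive edges telescope modulo two; a trail is needed so that
no edge is counted twice. -/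
theorem degree_edgesOf {u v : ℤ × ℤ} (p : gridGraph.Walk u v) (hp : p.IsTrail) (w : ℤ × ℤ) :
    degree (edgesOf p) w = ind {u} w + ind {v} w := by
  induction p with
  | nil => rw [add_self_zmod_two]; exact degree_eq_zero_of_forall_notMem (by simp [edgesOf])
  | @cons a b c h p ih =>
    rw [Walk.isTrail_cons] at hp
    rw [edgesOf_cons, degree_union (by simpa [edgesOf] using hp.2), degree_singleton h,
      ih hp.1]
    generalize ind {a} w = i
    generalize ind {b} w = j
    generalize ind {c} w = k
    revert i j k
    decide

/-- A path contains no nonempty even set of edges. -/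
theorem eq_empty_of_subset_path {u v : ℤ × ℤ} (p : gridGraph.Walk u v) (hp : p.IsPath)
    {F : Set (Sym2 (ℤ × ℤ))} (hF : IsEven F) (hsub : F ⊆ edgesOf p) : F = ∅ := by
  induction p with
  | nil => exact Set.eq_empty_of_subset_empty (by simpa [edgesOf] using hsub)
  | @cons a b c h p ih =>
    rw [Walk.cons_isPath_iff] at hp
    rw [edgesOf_cons] at hsub
    refine ih hp.1 ?_
    have hrest : ∀ e ∈ edgesOf p, a ∉ e := fun e he ha =>
      hp.2 (p.mem_support_of_mem_edges he ha)
    -- The first edge is the only edge of the path at `a`, so containing it would give `F` odd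
    -- degree there.
    have hnot : s(a, b) ∉ F := by
      intro hmem
      have h1 := degree_diff (Set.singleton_subset_iff.2 hmem) a
      rw [hF, degree_singleton h, ind_of_mem (Set.mem_singleton a),
        ind_of_notMem (by simpa using h.ne), add_zero, zero_add,
        degree_eq_zero_of_forall_notMem] at h1
      · exact zero_ne_one h1
      · intro e he
        rcases hsub he.1 with h' | h'
        · exact absurd h' he.2
        · exact hrest e h'
    intro e he
    rcases hsub he with h' | h'
    · rw [Set.mem_singleton_iff.1 h'] at he
      exact absurd he hnot
    · exact h'

theorem IsCycle.subset_edgeSet {C : Set (Sym2 (ℤ × ℤ))} (hC : IsCycle C) :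
    C ⊆ gridGraph.edgeSet := by
  obtain ⟨v, p, -, rfl⟩ := hC
  exact edgesOf_subset p

theorem IsCycle.finite {C : Set (Sym2 (ℤ × ℤ))} (hC : IsCycle C) : C.Finite := by
  obtain ⟨v, p, -, rfl⟩ := hC
  exact finite_edgesOf p

theorem IsCycle.nonempty {C : Set (Sym2 (ℤ × ℤ))} (hC : IsCycle C) : C.Nonempty := by
  obtain ⟨v, p, hp, rfl⟩ := hC
  cases p with
  | nil => exact absurd hp (by simp)
  | @cons _ b _ h p => exact ⟨s(v, b), by simp⟩

theorem IsCycle.isEven {C : Set (Sym2 (ℤ × ℤ))} (hC : IsCycle C) : IsEven C := by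
  obtain ⟨v, p, hp, rfl⟩ := hC
  intro w
  rw [← add_self_zmod_two (ind {v} w)]
  exact degree_edgesOf p hp.isTrail w

/-- A cycle contains no other nonempty even set of edges. -/
theorem IsCycle.eq_of_subset {C F : Set (Sym2 (ℤ × ℤ))} (hC : IsCycle C) (hF : IsEven F)
    (hne : F.Nonempty) (hsub : F ⊆ C) : F = C := by
  have hdiff := hC.isEven.diff hF hsub
  obtain ⟨v, p, hp, rfl⟩ := hC
  cases p with
  | nil => exact absurd hp (by simp)
  | @cons _ b _ h p =>
    rw [Walk.cons_isCycle_iff] at hp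
    change F = edgesOf _
    change F ⊆ edgesOf _ at hsub
    change IsEven (edgesOf _ \ F) at hdiff
    rw [edgesOf_cons] at hsub hdiff ⊢
    -- The cycle is one edge plus a path; whichever of `F` and its complement in the cycle avoids
    -- that edge is an even subset of the path, hence empty.
    by_cases he : s(v, b) ∈ F
    · refine hsub.antisymm (Set.sdiff_eq_empty.1 (eq_empty_of_subset_path p hp.1 hdiff ?_))
      rintro e ⟨h1 | h1, h2⟩
      · rw [Set.mem_singleton_iff.1 h1] at h2
        exact absurd he h2
      · exact h1
    · refine absurd (eq_empty_of_subset_path p hp.1 hF ?_) hne.ne_empty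
      intro e h2
      rcases hsub h2 with h1 | h1
      · rw [Set.mem_singleton_iff.1 h1] at h2
        exact absurd h2 he
      · exact h1

/-- If `u ≠ v`, the degree at `u` is odd, so some edge of `X` leaves `u`. Deleting it moves the odd
vertex `u` to the other end of the edge, and induction on the size of `X` applies. -/
theorem exists_walk_of_degree {X : Set (Sym2 (ℤ × ℤ))} (hX : X.Finite)
    (hsub : X ⊆ gridGraph.edgeSet) {u v : ℤ × ℤ}
    (h : ∀ w, degree X w = ind {u} w + ind {v} w) :
    ∃ p : gridGraph.Walk u v, edgesOf p ⊆ X := by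
  induction hn : X.ncard generalizing X u with
  | zero =>
    rw [Set.ncard_eq_zero hX] at hn
    subst hn
    by_cases huv : u = v
    · subst huv
      exact ⟨.nil, by simp [edgesOf]⟩
    · have := h u
      rw [degree_empty, ind_of_mem (Set.mem_singleton u), ind_of_notMem (by simpa using huv)] at this
      exact absurd this (by decide)
  | succ n ih =>
    by_cases huv : u = v
    · subst huv
      exact ⟨.nil, by simp [edgesOf]⟩
    · obtain ⟨e, he, hue⟩ : ∃ e ∈ X, u ∈ e := by
        apply exists_mem_of_degree_ne_zero
        rw [h u, ind_of_mem (Set.mem_singleton u), ind_of_notMem (by simpa using huv)]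
        decide
      obtain ⟨b, rfl⟩ := hue
      have hadj : gridGraph.Adj u b := hsub he
      obtain ⟨p, hp⟩ := ih (X := X \ {s(u, b)}) (u := b) hX.sdiff
        (Set.sdiff_subset.trans hsub) (fun w => by
          rw [degree_diff (Set.singleton_subset_iff.2 he), h, degree_singleton hadj]
          generalize ind {u} w = i
          generalize ind {b} w = j
          generalize ind {v} w = k
          revert i j k
          decide) (by
          rw [Set.ncard_sdiff_singleton_of_mem he, hn]; rfl)
      refine ⟨.cons hadj p, ?_⟩
      rw [edgesOf_cons]
      exact Set.union_subset (Set.singleton_subset_iff.2 he) (hp.trans Set.sdiff_subset)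

/-- Every edge of a finite even set lies in a cycle contained in this set. -/
theorem IsEven.exists_isCycle {X : Set (Sym2 (ℤ × ℤ))} (hX : IsEven X) (hfin : X.Finite)
    (hsub : X ⊆ gridGraph.edgeSet) {e : Sym2 (ℤ × ℤ)} (he : e ∈ X) :
    ∃ F, IsCycle F ∧ F ⊆ X ∧ e ∈ F := by
  induction e with
  | _ u v =>
    have hadj : gridGraph.Adj u v := hsub he
    -- Deleting the edge makes its two ends the only odd vertices; a path joining them in the rest
    -- closes up to a cycle.
    obtain ⟨p, hp⟩ := exists_walk_of_degree (X := X \ {s(u, v)}) (u := v) (v := u) hfin.sdiff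
      (Set.sdiff_subset.trans hsub) (fun w => by
        rw [degree_diff (Set.singleton_subset_iff.2 he), hX, degree_singleton hadj, zero_add,
          add_comm])
    have hp' : edgesOf p.bypass ⊆ X \ {s(u, v)} :=
      fun e he => hp (p.edges_bypass_subset_edges he)
    refine ⟨edgesOf (.cons hadj p.bypass), ⟨u, .cons hadj p.bypass, ?_, rfl⟩, ?_, ?_⟩
    · rw [Walk.cons_isCycle_iff]
      exact ⟨p.bypass_isPath, fun h => (hp' h).2 rfl⟩
    · rw [edgesOf_cons]
      exact Set.union_subset (Set.singleton_subset_iff.2 he) (hp'.trans Set.sdiff_subset)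
    · rw [edgesOf_cons]
      exact Or.inl rfl

/-- Two vertices of a cycle are joined by a trail inside the cycle. -/
theorem IsCycle.exists_trail {C : Set (Sym2 (ℤ × ℤ))} (hC : IsCycle C) {u v : ℤ × ℤ}
    (hu : u ∈ vertices C) (hv : v ∈ vertices C) :
    ∃ P ⊆ C, ∀ w, degree P w = ind {u} w + ind {v} w := by
  obtain ⟨a, p, hp, rfl⟩ := hC
  obtain ⟨e, he, hue⟩ := hu
  obtain ⟨f, hf, hvf⟩ := hv
  have hu' : u ∈ p.support := p.mem_support_of_mem_edges he hue
  have hq : (p.rotate u hu').IsCycle := hp.rotate hu'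
  have hqe : ∀ e, e ∈ (p.rotate u hu').edges ↔ e ∈ p.edges := fun e =>
    (p.rotate_edges u hu').mem_iff
  have hv' : v ∈ (p.rotate u hu').support :=
    (p.rotate u hu').mem_support_of_mem_edges ((hqe f).2 hf) hvf
  refine ⟨edgesOf ((p.rotate u hu').takeUntil v hv'), fun e he => ?_, fun w => ?_⟩
  · exact (hqe e).1 ((p.rotate u hu').edges_takeUntil_subset_edges hv' he)
  · exact degree_edgesOf _ (hq.isTrail.takeUntil hv') w

/-- The squares in the interior of a cycle are the only nonempty finite set of squares whose
boundary is contained in the cycle. -/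
theorem IsCycle.eq_of_boundary_subset {A X : Set (ℤ × ℤ)} (hC : IsCycle (boundary A))
    (hA : A.Finite) (hX : X.Finite) (hne : X.Nonempty) (h : boundary X ⊆ boundary A) : X = A :=
  boundary_injOn hX hA (hC.eq_of_subset (isEven_boundary X) (boundary_nonempty hX hne) h)

theorem IsCycle.exists_boundary_eq {C : Set (Sym2 (ℤ × ℤ))} (hC : IsCycle C) :
    ∃ A : Set (ℤ × ℤ), A.Finite ∧ boundary A = C :=
  hC.isEven.exists_boundary_eq hC.finite hC.subset_edgeSet

/-- Two edge-disjoint cycles with two common vertices have a third cycle in their union that has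
an edge in common with the first one. -/
theorem IsCycle.exists_third_cycle {C D : Set (Sym2 (ℤ × ℤ))} (hC : IsCycle C) (hD : IsCycle D)
    (hdisj : Disjoint C D) (h : (vertices C ∩ vertices D).Nontrivial) :
    ∃ Q, IsCycle Q ∧ Q ⊆ C ∪ D ∧ (Q ∩ C).Nonempty ∧ Q ≠ C := by
  obtain ⟨u, ⟨huC, huD⟩, v, ⟨hvC, hvD⟩, huv⟩ := h
  have hone : ind {u} u + ind {v} u = 1 := by
    rw [ind_of_mem (Set.mem_singleton u), ind_of_notMem (by simpa using huv), add_zero]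
  -- A cycle within the trail `P` would be all of `C`, so `P = C`, although `P` has odd degree at
  -- `u`.
  have aux : ∀ {C : Set (Sym2 (ℤ × ℤ))}, IsCycle C → ∀ {P Q}, P ⊆ C →
      (∀ w, degree P w = ind {u} w + ind {v} w) → IsCycle Q → ¬ Q ⊆ P := by
    intro C hC P Q hPC hP hQ hQP
    have := hC.eq_of_subset hQ.isEven hQ.nonempty (hQP.trans hPC)
    subst this
    have h1 := hP u
    rw [hPC.antisymm hQP, hC.isEven, hone] at h1
    exact zero_ne_one h1
  obtain ⟨P, hPC, hP⟩ := hC.exists_trail huC hvC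
  obtain ⟨R, hRD, hR⟩ := hD.exists_trail huD hvD
  have heven : IsEven (P ∪ R) := fun w => by
    rw [degree_union (hdisj.mono hPC hRD), hP, hR, add_self_zmod_two]
  obtain ⟨e, he, -⟩ := exists_mem_of_degree_ne_zero (C := P) (w := u)
    (by rw [hP, hone]; exact one_ne_zero)
  have hsub : P ∪ R ⊆ C ∪ D := Set.union_subset_union hPC hRD
  -- By `aux`, `Q` lies in neither trail: not in `R`, so it has an edge of `C`; not in `P`, so it
  -- differs from `C`.
  obtain ⟨Q, hQ, hQP, -⟩ := heven.exists_isCycle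
    ((hC.finite.union hD.finite).subset hsub)
    (hsub.trans (Set.union_subset hC.subset_edgeSet hD.subset_edgeSet)) (Or.inl he)
  refine ⟨Q, hQ, hQP.trans hsub, ?_, ?_⟩
  · obtain ⟨f, hf, hfR⟩ := Set.not_subset.1 (aux hD hRD hR hQ)
    exact ⟨f, hf, hPC ((hQP hf).resolve_right hfR)⟩
  · rintro rfl
    refine aux hC hPC hP hQ fun f hf => (hQP hf).resolve_right fun hfR => ?_
    exact Set.disjoint_left.1 hdisj hf (hRD hfR)

/-! ### The plane: components of the complement of a cycle in terms of squares. -/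

/-- The closed unit square of the tiling with centre `z`. -/
def closedSquare (z : ℤ × ℤ) : Set (ℝ × ℝ) :=
  Set.Icc ((z.1 : ℝ) - 1 / 2) ((z.1 : ℝ) + 1 / 2) ×ˢ
    Set.Icc ((z.2 : ℝ) - 1 / 2) ((z.2 : ℝ) + 1 / 2)

theorem mem_closedSquare {z : ℤ × ℤ} {p : ℝ × ℝ} : p ∈ closedSquare z ↔
    ((z.1 : ℝ) - 1 / 2 ≤ p.1 ∧ p.1 ≤ (z.1 : ℝ) + 1 / 2) ∧
      ((z.2 : ℝ) - 1 / 2 ≤ p.2 ∧ p.2 ≤ (z.2 : ℝ) + 1 / 2) := Iff.rfl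

theorem mem_square {z : ℤ × ℤ} {p : ℝ × ℝ} : p ∈ square z ↔
    ((z.1 : ℝ) - 1 / 2 < p.1 ∧ p.1 < (z.1 : ℝ) + 1 / 2) ∧
      ((z.2 : ℝ) - 1 / 2 < p.2 ∧ p.2 < (z.2 : ℝ) + 1 / 2) := Iff.rfl

theorem closure_square (z : ℤ × ℤ) : closure (square z) = closedSquare z := by
  rw [square, closure_prod_eq, closure_Ioo (by linarith), closure_Ioo (by linarith)]
  rfl

theorem square_subset_closedSquare (z : ℤ × ℤ) : square z ⊆ closedSquare z :=
  closure_square z ▸ subset_closure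

theorem isPreconnected_square (z : ℤ × ℤ) : IsPreconnected (square z) :=
  isPreconnected_Ioo.prod isPreconnected_Ioo

theorem centre_mem_square (z : ℤ × ℤ) : ((z.1 : ℝ), (z.2 : ℝ)) ∈ square z := by
  rw [mem_square]; constructor <;> constructor <;> simp only <;> linarith

theorem exists_mem_closedSquare (p : ℝ × ℝ) : ∃ z, p ∈ closedSquare z := by
  refine ⟨(round p.1, round p.2), mem_closedSquare.2 ⟨?_, ?_⟩⟩
  · have := abs_le.1 (abs_sub_round p.1)
    simp only
    constructor <;> linarith
  · have := abs_le.1 (abs_sub_round p.2)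
    simp only
    constructor <;> linarith

theorem segment_hEdge (x y : ℤ) : segment ℝ (point (x - 1, y)) (point (x, y)) =
    Set.Icc ((x : ℝ) - 1 / 2) ((x : ℝ) + 1 / 2) ×ˢ {(y : ℝ) + 1 / 2} := by
  simp only [point]
  rw [← Prod.image_mk_segment_left, segment_eq_Icc (by push_cast; linarith), Set.prod_singleton]
  congr 2
  push_cast
  ring

theorem segment_vEdge (x y : ℤ) : segment ℝ (point (x, y - 1)) (point (x, y)) =
    {(x : ℝ) + 1 / 2} ×ˢ Set.Icc ((y : ℝ) - 1 / 2) ((y : ℝ) + 1 / 2) := by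
  simp only [point]
  rw [← Prod.image_mk_segment_right, segment_eq_Icc (by push_cast; linarith), Set.singleton_prod]
  congr 2
  push_cast
  ring

theorem mem_trace_of_hEdge {C : Set (Sym2 (ℤ × ℤ))} {x y : ℤ} (h : hEdge x y ∈ C) {p : ℝ × ℝ}
    (h1 : (x : ℝ) - 1 / 2 ≤ p.1) (h2 : p.1 ≤ (x : ℝ) + 1 / 2) (h3 : p.2 = (y : ℝ) + 1 / 2) :
    p ∈ trace C := by
  refine ⟨_, _, h, ?_⟩
  rw [segment_hEdge]
  exact ⟨⟨h1, h2⟩, h3⟩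

theorem mem_trace_of_vEdge {C : Set (Sym2 (ℤ × ℤ))} {x y : ℤ} (h : vEdge x y ∈ C) {p : ℝ × ℝ}
    (h1 : p.1 = (x : ℝ) + 1 / 2) (h2 : (y : ℝ) - 1 / 2 ≤ p.2) (h3 : p.2 ≤ (y : ℝ) + 1 / 2) :
    p ∈ trace C := by
  refine ⟨_, _, h, ?_⟩
  rw [segment_vEdge]
  exact ⟨h1, h2, h3⟩

theorem mem_trace_cases {C : Set (Sym2 (ℤ × ℤ))} (hC : C ⊆ gridGraph.edgeSet) {p : ℝ × ℝ}
    (h : p ∈ trace C) :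
    (∃ x y : ℤ, hEdge x y ∈ C ∧ ((x : ℝ) - 1 / 2 ≤ p.1 ∧ p.1 ≤ (x : ℝ) + 1 / 2) ∧
        p.2 = (y : ℝ) + 1 / 2) ∨
      ∃ x y : ℤ, vEdge x y ∈ C ∧ p.1 = (x : ℝ) + 1 / 2 ∧
        ((y : ℝ) - 1 / 2 ≤ p.2 ∧ p.2 ≤ (y : ℝ) + 1 / 2) := by
  obtain ⟨u, v, huv, hp⟩ := h
  rcases edge_cases (hC huv) with ⟨x, y, e⟩ | ⟨x, y, e⟩
  · refine Or.inl ⟨x, y, e ▸ huv, ?_⟩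
    have : segment ℝ (point u) (point v) = segment ℝ (point (x - 1, y)) (point (x, y)) := by
      rcases Sym2.eq_iff.1 e with ⟨rfl, rfl⟩ | ⟨rfl, rfl⟩
      · rfl
      · exact segment_symm _ _ _
    rw [this, segment_hEdge] at hp
    exact ⟨hp.1, hp.2⟩
  · refine Or.inr ⟨x, y, e ▸ huv, ?_⟩
    have : segment ℝ (point u) (point v) = segment ℝ (point (x, y - 1)) (point (x, y)) := by
      rcases Sym2.eq_iff.1 e with ⟨rfl, rfl⟩ | ⟨rfl, rfl⟩
      · rfl
      · exact segment_symm _ _ _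
    rw [this, segment_vEdge] at hp
    exact ⟨hp.1, hp.2⟩

theorem int_half_not_between {a b : ℤ} (h1 : (a : ℝ) - 1 / 2 < (b : ℝ) + 1 / 2)
    (h2 : (b : ℝ) + 1 / 2 < (a : ℝ) + 1 / 2) : False := by
  have h3 : a < b + 1 := by exact_mod_cast (by linarith : (a : ℝ) < b + 1)
  have h4 : b < a := by exact_mod_cast (by linarith : (b : ℝ) < a)
  omega

theorem notMem_trace_of_mem_square {C : Set (Sym2 (ℤ × ℤ))} (hC : C ⊆ gridGraph.edgeSet)
    {z : ℤ × ℤ} {p : ℝ × ℝ} (hp : p ∈ square z) : p ∉ trace C := by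
  intro h
  obtain ⟨⟨h1, h2⟩, h3, h4⟩ := mem_square.1 hp
  rcases mem_trace_cases hC h with ⟨x, y, -, -, h5⟩ | ⟨x, y, -, h5, -⟩
  · rw [h5] at h3 h4
    exact int_half_not_between h3 h4
  · rw [h5] at h1 h2
    exact int_half_not_between h1 h2

theorem exists_square_of_mem_trace_boundary {A : Set (ℤ × ℤ)} {p : ℝ × ℝ}
    (hp : p ∈ trace (boundary A)) : ∃ z ∉ A, p ∈ closedSquare z := by
  rcases mem_trace_cases (boundary_subset_edgeSet A) hp with
    ⟨x, y, hm, ⟨h1, h2⟩, h3⟩ | ⟨x, y, hm, h3, h1, h2⟩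
  · rw [hEdge_mem_boundary] at hm
    by_cases h : (x, y) ∈ A
    · refine ⟨(x, y + 1), by tauto, mem_closedSquare.2 ⟨⟨h1, h2⟩, ?_, ?_⟩⟩ <;>
        push_cast <;> linarith
    · exact ⟨(x, y), h, mem_closedSquare.2 ⟨⟨h1, h2⟩, by simp only; linarith, h3.le⟩⟩
  · rw [vEdge_mem_boundary] at hm
    by_cases h : (x, y) ∈ A
    · refine ⟨(x + 1, y), by tauto, mem_closedSquare.2 ⟨⟨?_, ?_⟩, h1, h2⟩⟩ <;>
        push_cast <;> linarith
    · exact ⟨(x, y), h, mem_closedSquare.2 ⟨⟨by simp only; linarith, h3.le⟩, h1, h2⟩⟩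

theorem mem_trace_boundary_of_snd_eq {A : Set (ℤ × ℤ)} {p : ℝ × ℝ} {x x' y : ℤ}
    (h : (x, y) ∈ A) (h' : (x', y) ∉ A) (hp : p ∈ closedSquare (x, y))
    (hp' : p ∈ closedSquare (x', y)) : p ∈ trace (boundary A) := by
  obtain ⟨⟨h1, h2⟩, h3, h4⟩ := mem_closedSquare.1 hp
  obtain ⟨⟨h5, h6⟩, -, -⟩ := mem_closedSquare.1 hp'
  simp only at h1 h2 h3 h4 h5 h6
  have h7 : x ≤ x' + 1 := by exact_mod_cast (by linarith : (x : ℝ) ≤ x' + 1)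
  have h8 : x' ≤ x + 1 := by exact_mod_cast (by linarith : (x' : ℝ) ≤ x + 1)
  obtain rfl | rfl | rfl : x' = x ∨ x' = x + 1 ∨ x = x' + 1 := by omega
  · exact absurd h h'
  · refine mem_trace_of_vEdge (x := x) (y := y) (vEdge_mem_boundary.2 (by tauto)) ?_ h3 h4
    push_cast at h5
    linarith
  · refine mem_trace_of_vEdge (x := x') (y := y) (vEdge_mem_boundary.2 (by tauto)) ?_ h3 h4
    push_cast at h1
    linarith

theorem mem_trace_boundary_of_fst_eq {A : Set (ℤ × ℤ)} {p : ℝ × ℝ} {x y y' : ℤ}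
    (h : (x, y) ∈ A) (h' : (x, y') ∉ A) (hp : p ∈ closedSquare (x, y))
    (hp' : p ∈ closedSquare (x, y')) : p ∈ trace (boundary A) := by
  obtain ⟨⟨h1, h2⟩, h3, h4⟩ := mem_closedSquare.1 hp
  obtain ⟨-, h5, h6⟩ := mem_closedSquare.1 hp'
  simp only at h1 h2 h3 h4 h5 h6
  have h7 : y ≤ y' + 1 := by exact_mod_cast (by linarith : (y : ℝ) ≤ y' + 1)
  have h8 : y' ≤ y + 1 := by exact_mod_cast (by linarith : (y' : ℝ) ≤ y + 1)
  obtain rfl | rfl | rfl : y' = y ∨ y' = y + 1 ∨ y = y' + 1 := by omega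
  · exact absurd h h'
  · refine mem_trace_of_hEdge (x := x) (y := y) (hEdge_mem_boundary.2 (by tauto)) h1 h2 ?_
    push_cast at h5
    linarith
  · refine mem_trace_of_hEdge (x := x) (y := y') (hEdge_mem_boundary.2 (by tauto)) h1 h2 ?_
    push_cast at h3
    linarith

/-- A point common to a closed square in `A` and one not in `A` lies on the boundary of `A`. -/
theorem mem_trace_boundary {A : Set (ℤ × ℤ)} {p : ℝ × ℝ} {z z' : ℤ × ℤ}
    (h : z ∈ A) (h' : z' ∉ A) (hp : p ∈ closedSquare z) (hp' : p ∈ closedSquare z') :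
    p ∈ trace (boundary A) := by
  obtain ⟨x, y⟩ := z
  obtain ⟨x', y'⟩ := z'
  -- This square also contains `p` and shares a row with one square and a column with the other,
  -- which reduces diagonal contact to the aligned cases.
  have hw : p ∈ closedSquare (x', y) := ⟨hp'.1, hp.2⟩
  by_cases hA : (x', y) ∈ A
  · exact mem_trace_boundary_of_fst_eq hA h' hw hp'
  · exact mem_trace_boundary_of_snd_eq h hA hp hw

/-- A bounded set meets only finitely many closed squares. -/
theorem finite_setOf_closedSquare_inter_nonempty {s : Set (ℝ × ℝ)}
    (hs : Bornology.IsBounded s) : {z | (closedSquare z ∩ s).Nonempty}.Finite := by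
  obtain ⟨R, hR⟩ := hs.subset_closedBall (0 : ℝ × ℝ)
  refine ((Set.finite_Icc (-⌈R + 1⌉) ⌈R + 1⌉).prod
    (Set.finite_Icc (-⌈R + 1⌉) ⌈R + 1⌉)).subset ?_
  rintro ⟨x, y⟩ ⟨p, hp, hps⟩
  obtain ⟨⟨h1, h2⟩, h3, h4⟩ := mem_closedSquare.1 hp
  have h5 := hR hps
  rw [mem_closedBall_zero_iff, Prod.norm_def, max_le_iff, Real.norm_eq_abs, Real.norm_eq_abs,
    abs_le, abs_le] at h5
  obtain ⟨⟨h5, h6⟩, h7, h8⟩ := h5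
  have h9 := Int.le_ceil (R + 1)
  simp only at h1 h2 h3 h4
  simp only [Set.mem_prod, Set.mem_Icc]
  refine ⟨⟨?_, ?_⟩, ?_, ?_⟩ <;> rify <;> linarith

/-- Makes unions of infinitely many closed squares closed, as needed for the complement of a finite
set of squares. -/
theorem locallyFinite_closedSquare : LocallyFinite closedSquare := fun p =>
  ⟨Metric.ball p 1, Metric.ball_mem_nhds p one_pos,
    finite_setOf_closedSquare_inter_nonempty Metric.isBounded_ball⟩

theorem isClosed_biUnion_closedSquare (A : Set (ℤ × ℤ)) :
    IsClosed (⋃ z : A, closedSquare z) :=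
  (locallyFinite_closedSquare.comp_injective Subtype.val_injective).isClosed_iUnion
    fun _ => isClosed_Icc.prod isClosed_Icc

theorem isBounded_biUnion_closedSquare {A : Set (ℤ × ℤ)} (hA : A.Finite) :
    Bornology.IsBounded (⋃ z : A, closedSquare z) := by
  have := hA.to_subtype
  exact (Bornology.isBounded_iUnion).2 fun z =>
    (Metric.isBounded_Icc _ _).prod (Metric.isBounded_Icc _ _)

/-- A point off the trace of `C` lies in the same component as the squares touching it. -/
theorem square_subset_component {C : Set (Sym2 (ℤ × ℤ))} (hC : C ⊆ gridGraph.edgeSet)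
    {p q : ℝ × ℝ} {z : ℤ × ℤ} (hp : p ∉ trace C) (hz : p ∈ closedSquare z)
    (hq : p ∈ connectedComponentIn (trace C)ᶜ q) :
    square z ⊆ connectedComponentIn (trace C)ᶜ q := by
  rw [connectedComponentIn_eq hq]
  have hconn : IsPreconnected (insert p (square z)) :=
    (isPreconnected_square z).subset_closure (Set.subset_insert _ _)
      (Set.insert_subset (closure_square z ▸ hz) subset_closure)
  refine (Set.subset_insert _ _).trans
    (hconn.subset_connectedComponentIn (Set.mem_insert _ _) ?_)
  exact Set.insert_subset hp fun x hx => notMem_trace_of_mem_square hC hx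

theorem mem_component_of_square_subset {C : Set (Sym2 (ℤ × ℤ))} (hC : C ⊆ gridGraph.edgeSet)
    {p q : ℝ × ℝ} {z : ℤ × ℤ} (hp : p ∉ trace C) (hz : p ∈ closedSquare z)
    (hq : square z ⊆ connectedComponentIn (trace C)ᶜ q) :
    p ∈ connectedComponentIn (trace C)ᶜ q := by
  have h1 := square_subset_component hC hp hz (mem_connectedComponentIn hp)
  have h2 := centre_mem_square z
  rw [connectedComponentIn_eq (hq h2), ← connectedComponentIn_eq (h1 h2)]
  exact mem_connectedComponentIn hp

/-- The component of a point in a square of a finite set `A` does not leave `A` without meeting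
the boundary of `A`. -/
theorem isBounded_component {A : Set (ℤ × ℤ)} (hA : A.Finite) {z : ℤ × ℤ} (hz : z ∈ A)
    {p : ℝ × ℝ} (hp : p ∉ trace (boundary A)) (hpz : p ∈ closedSquare z) :
    Bornology.IsBounded (connectedComponentIn (trace (boundary A))ᶜ p) := by
  refine (isBounded_biUnion_closedSquare hA).subset ?_
  by_contra hc
  obtain ⟨q, hq, hqA⟩ := Set.not_subset.1 hc
  -- The closed unions over `A` and `Aᶜ` cover the plane and overlap only on the trace, so a
  -- connected set off the trace cannot meet both.
  have hconn := isPreconnected_closed_iff.1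
    (isPreconnected_connectedComponentIn (F := (trace (boundary A))ᶜ) (x := p))
    _ _ (isClosed_biUnion_closedSquare A) (isClosed_biUnion_closedSquare Aᶜ) ?_
    ⟨p, mem_connectedComponentIn hp, Set.mem_iUnion.2 ⟨⟨z, hz⟩, hpz⟩⟩ ?_
  · obtain ⟨r, hr, hr1, hr2⟩ := hconn
    obtain ⟨a, ha⟩ := Set.mem_iUnion.1 hr1
    obtain ⟨b, hb⟩ := Set.mem_iUnion.1 hr2
    exact connectedComponentIn_subset _ _ hr (mem_trace_boundary a.2 b.2 ha hb)
  · intro r _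
    obtain ⟨w, hw⟩ := exists_mem_closedSquare r
    by_cases h : w ∈ A
    · exact Or.inl (Set.mem_iUnion.2 ⟨⟨w, h⟩, hw⟩)
    · exact Or.inr (Set.mem_iUnion.2 ⟨⟨w, h⟩, hw⟩)
  · obtain ⟨w, hw⟩ := exists_mem_closedSquare q
    refine ⟨q, hq, Set.mem_iUnion.2 ⟨⟨w, fun h => hqA ?_⟩, hw⟩⟩
    exact Set.mem_iUnion.2 ⟨⟨w, h⟩, hw⟩

/-- The squares in a component of the complement of `C` have their boundary in `C`. -/
theorem boundary_setOf_square_subset {C : Set (Sym2 (ℤ × ℤ))} (hC : C ⊆ gridGraph.edgeSet)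
    (p : ℝ × ℝ) :
    boundary {z | square z ⊆ connectedComponentIn (trace C)ᶜ p} ⊆ C := by
  rintro e ⟨z, hz, z', hz', h1, h2⟩
  by_contra he
  -- The midpoint of `e` lies on no other edge, so it links the two squares off the trace.
  obtain ⟨m, hm, hmz, hmz'⟩ : ∃ m, m ∉ trace C ∧ m ∈ closedSquare z ∧ m ∈ closedSquare z' := by
    rcases edge_cases h1.1 with ⟨x, y, rfl⟩ | ⟨x, y, rfl⟩
    · refine ⟨((x : ℝ), (y : ℝ) + 1 / 2), fun hm => ?_, ?_⟩
      · rcases mem_trace_cases hC hm with ⟨a, b, hab, ⟨h3, h4⟩, h5⟩ | ⟨a, b, hab, h5, -⟩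
        · simp only at h3 h4 h5
          have h6 : y = b := by exact_mod_cast (by linarith : (y : ℝ) = b)
          have h7 : x < a + 1 := by exact_mod_cast (by linarith : (x : ℝ) < a + 1)
          have h8 : a < x + 1 := by exact_mod_cast (by linarith : (a : ℝ) < x + 1)
          obtain rfl : x = a := by omega
          subst h6
          exact he hab
        · simp only at h5
          exact int_half_not_between (a := x) (b := a) (by linarith) (by linarith)
      · rw [isEdgeOfSquare_hEdge] at h1 h2
        simp only [mem_closedSquare]
        constructor
        · rcases h1 with rfl | rfl <;> push_cast <;>
            refine ⟨⟨?_, ?_⟩, ?_, ?_⟩ <;> linarith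
        · rcases h2 with rfl | rfl <;> push_cast <;>
            refine ⟨⟨?_, ?_⟩, ?_, ?_⟩ <;> linarith
    · refine ⟨((x : ℝ) + 1 / 2, (y : ℝ)), fun hm => ?_, ?_⟩
      · rcases mem_trace_cases hC hm with ⟨a, b, hab, -, h5⟩ | ⟨a, b, hab, h5, h3, h4⟩
        · simp only at h5
          exact int_half_not_between (a := y) (b := b) (by linarith) (by linarith)
        · simp only at h3 h4 h5
          have h6 : x = a := by exact_mod_cast (by linarith : (x : ℝ) = a)
          have h7 : y < b + 1 := by exact_mod_cast (by linarith : (y : ℝ) < b + 1)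
          have h8 : b < y + 1 := by exact_mod_cast (by linarith : (b : ℝ) < y + 1)
          obtain rfl : y = b := by omega
          subst h6
          exact he hab
      · rw [isEdgeOfSquare_vEdge] at h1 h2
        simp only [mem_closedSquare]
        constructor
        · rcases h1 with rfl | rfl <;> push_cast <;>
            refine ⟨⟨?_, ?_⟩, ?_, ?_⟩ <;> linarith
        · rcases h2 with rfl | rfl <;> push_cast <;>
            refine ⟨⟨?_, ?_⟩, ?_, ?_⟩ <;> linarith
  exact hz' (square_subset_component hC hm hmz' (mem_component_of_square_subset hC hm hmz hz))

/-- The bridge from topology to squares. A bounded component contains finitely many squares, and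
their boundary lies in the cycle, so minimality makes them exactly `A`. -/
theorem mem_inside_iff {A : Set (ℤ × ℤ)} (hC : IsCycle (boundary A)) (hA : A.Finite)
    {p : ℝ × ℝ} {z : ℤ × ℤ} (hp : p ∉ trace (boundary A)) (hz : p ∈ closedSquare z) :
    p ∈ inside (boundary A) ↔ z ∈ A := by
  refine ⟨fun h => ?_, fun h => ⟨hp, isBounded_component hA h hp hz⟩⟩
  have hX : z ∈ {z | square z ⊆ connectedComponentIn (trace (boundary A))ᶜ p} :=
    square_subset_component hC.subset_edgeSet hp hz (mem_connectedComponentIn hp)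
  have hfin : {z | square z ⊆ connectedComponentIn (trace (boundary A))ᶜ p}.Finite := by
    refine (finite_setOf_closedSquare_inter_nonempty h.2).subset fun w hw => ?_
    exact ⟨_, square_subset_closedSquare w (centre_mem_square w), hw (centre_mem_square w)⟩
  rwa [hC.eq_of_boundary_subset hA hfin ⟨z, hX⟩
    (boundary_setOf_square_subset hC.subset_edgeSet p)] at hX

theorem square_subset_inside_iff {A : Set (ℤ × ℤ)} (hC : IsCycle (boundary A)) (hA : A.Finite)
    {z : ℤ × ℤ} : square z ⊆ inside (boundary A) ↔ z ∈ A := by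
  have h : ∀ p ∈ square z, p ∈ inside (boundary A) ↔ z ∈ A := fun p hp =>
    mem_inside_iff hC hA (notMem_trace_of_mem_square hC.subset_edgeSet hp)
      (square_subset_closedSquare z hp)
  exact ⟨fun h' => (h _ (centre_mem_square z)).1 (h' (centre_mem_square z)),
    fun h' p hp => (h p hp).2 h'⟩

theorem square_subset_outside_iff {A : Set (ℤ × ℤ)} (hC : IsCycle (boundary A)) (hA : A.Finite)
    {z : ℤ × ℤ} : square z ⊆ outside (boundary A) ↔ z ∉ A := by
  have h : ∀ p ∈ square z, p ∈ outside (boundary A) ↔ z ∉ A := fun p hp => by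
    have hp' := notMem_trace_of_mem_square hC.subset_edgeSet hp
    rw [← mem_inside_iff hC hA hp' (square_subset_closedSquare z hp)]
    exact ⟨fun h1 h2 => h1.2 h2.2, fun h1 => ⟨hp', fun h2 => h1 ⟨hp', h2⟩⟩⟩
  exact ⟨fun h' => (h _ (centre_mem_square z)).1 (h' (centre_mem_square z)),
    fun h' p hp => (h p hp).2 h'⟩

theorem inside_subset_inside_iff {A A' : Set (ℤ × ℤ)} (hC : IsCycle (boundary A))
    (hA : A.Finite) (hC' : IsCycle (boundary A')) (hA' : A'.Finite) :
    inside (boundary A) ⊆ inside (boundary A') ↔ A ⊆ A' := by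
  constructor
  · intro h z hz
    exact (square_subset_inside_iff hC' hA').1 (((square_subset_inside_iff hC hA).2 hz).trans h)
  · intro h p hp
    obtain ⟨z, hz⟩ := exists_mem_closedSquare p
    -- A point on this trace touches a square outside `A'`, whereas every square touching `p`
    -- belongs to `A ⊆ A'`.
    have hp' : p ∉ trace (boundary A') := by
      intro hp'
      obtain ⟨w, hw, hpw⟩ := exists_square_of_mem_trace_boundary hp'
      exact hw (h ((mem_inside_iff hC hA hp.1 hpw).1 hp))
    exact (mem_inside_iff hC' hA' hp' hz).2 (h ((mem_inside_iff hC hA hp.1 hz).1 hp))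

theorem edgeInside_iff {A : Set (ℤ × ℤ)} (hC : IsCycle (boundary A)) (hA : A.Finite)
    {e : Sym2 (ℤ × ℤ)} : EdgeInside e (boundary A) ↔
      e ∈ gridGraph.edgeSet ∧ ∀ z, IsEdgeOfSquare e z → z ∈ A := by
  simp only [EdgeInside, square_subset_inside_iff hC hA]

theorem edgeOutside_iff {A : Set (ℤ × ℤ)} (hC : IsCycle (boundary A)) (hA : A.Finite)
    {e : Sym2 (ℤ × ℤ)} : EdgeOutside e (boundary A) ↔
      e ∈ gridGraph.edgeSet ∧ ∀ z, IsEdgeOfSquare e z → z ∉ A := by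
  simp only [EdgeOutside, square_subset_outside_iff hC hA]

/-! ### The largest set of squares and the merger. -/

/-- The finite sets of squares whose boundary is contained in a finite set have a largest
element. -/
theorem exists_greatest_boundary_subset {S : Set (Sym2 (ℤ × ℤ))} (hS : S.Finite) :
    ∃ B : Set (ℤ × ℤ), B.Finite ∧ boundary B ⊆ S ∧
      ∀ X : Set (ℤ × ℤ), X.Finite → boundary X ⊆ S → X ⊆ B := by
  have hfin : {X : Set (ℤ × ℤ) | X.Finite ∧ boundary X ⊆ S}.Finite := by
    refine Set.Finite.of_finite_image (f := boundary) (hS.finite_subsets.subset ?_)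
      (boundary_injOn.mono fun X h => h.1)
    rintro _ ⟨X, hX, rfl⟩
    exact hX.2
  exact ⟨⋃₀ {X | X.Finite ∧ boundary X ⊆ S}, hfin.sUnion fun X hX => hX.1,
    boundary_sUnion_subset fun X hX => hX.2, fun X h1 h2 => Set.subset_sUnion_of_mem ⟨h1, h2⟩⟩

/-- If the interiors of two cycles in `B` meet, and the second cycle is part of the boundary
of `B`, then the first interior is contained in the second. -/
theorem IsCycle.subset_of_inter_nonempty {A A' B : Set (ℤ × ℤ)} (hC : IsCycle (boundary A))
    (hA : A.Finite) (hAB : A ⊆ B) (hA' : boundary A' ⊆ boundary B) (h : (A ∩ A').Nonempty) :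
    A ⊆ A' := by
  have : A ∩ A' = A := by
    refine hC.eq_of_boundary_subset hA (hA.subset Set.inter_subset_left) h fun e he => ?_
    rcases boundary_inter_subset A A' he with h' | h'
    · exact h'
    -- Such an edge lies in `boundary B`, so it has a square outside `B`, and that square is outside
    -- `A` too.
    · obtain ⟨z, hz, -, -, hez, -⟩ := he
      obtain ⟨-, -, w, hw, -, hew⟩ := hA' h'
      exact ⟨z, hz.1, w, fun h => hw (hAB h), hez, hew⟩
  exact Set.inter_eq_left.1 this

/-- The interiors of two cycles in `B` meet if the cycles have a common edge in the boundary
of `B`. -/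
theorem inter_nonempty_of_mem_boundary {A A' B : Set (ℤ × ℤ)} (hAB : A ⊆ B) (hAB' : A' ⊆ B)
    {e : Sym2 (ℤ × ℤ)} (h : e ∈ boundary A) (h' : e ∈ boundary A') (hB : e ∈ boundary B) :
    (A ∩ A').Nonempty := by
  obtain ⟨z, hz, -, -, h1, -⟩ := h
  obtain ⟨w, hw, -, -, h2, -⟩ := h'
  obtain rfl := eq_of_mem_boundary hB h1 h2 (iff_of_true (hAB hz) (hAB' hw))
  exact ⟨z, hz, hw⟩

section Greatest

variable {S : Set (Sym2 (ℤ × ℤ))} {B : Set (ℤ × ℤ)}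

/-- Two cycles in the boundary of the largest set `B` that have a common edge are equal. -/
theorem IsCycle.eq_of_mem (hBS : boundary B ⊆ S)
    (hmax : ∀ X : Set (ℤ × ℤ), X.Finite → boundary X ⊆ S → X ⊆ B)
    {F F' : Set (Sym2 (ℤ × ℤ))} (hF : IsCycle F) (hF' : IsCycle F') (hFB : F ⊆ boundary B)
    (hFB' : F' ⊆ boundary B) {e : Sym2 (ℤ × ℤ)} (he : e ∈ F) (he' : e ∈ F') : F = F' := by
  obtain ⟨A, hA, rfl⟩ := hF.exists_boundary_eq
  obtain ⟨A', hA', rfl⟩ := hF'.exists_boundary_eq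
  have h1 := hmax A hA (hFB.trans hBS)
  have h2 := hmax A' hA' (hFB'.trans hBS)
  have h := inter_nonempty_of_mem_boundary h1 h2 he he' (hFB he)
  exact congrArg boundary ((hF.subset_of_inter_nonempty hA h1 hFB' h).antisymm
    (hF'.subset_of_inter_nonempty hA' h2 hFB (Set.inter_comm A A' ▸ h)))

/-- The boundary edges of the largest set `B` in a given cycle lie in a single cycle of the
boundary. -/
theorem IsCycle.exists_isCycle_inter_subset (hB : B.Finite) (hne : B.Nonempty)
    (hBS : boundary B ⊆ S) (hS : S.Finite)
    (hmax : ∀ X : Set (ℤ × ℤ), X.Finite → boundary X ⊆ S → X ⊆ B)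
    {C : Set (Sym2 (ℤ × ℤ))} (hC : IsCycle C) (hCS : C ⊆ S) :
    ∃ F, IsCycle F ∧ F ⊆ boundary B ∧ boundary B ∩ C ⊆ F := by
  have hex : ∀ e ∈ boundary B, ∃ F, IsCycle F ∧ F ⊆ boundary B ∧ e ∈ F := fun e he =>
    (isEven_boundary B).exists_isCycle (hS.subset hBS) (boundary_subset_edgeSet B) he
  rcases (boundary B ∩ C).eq_empty_or_nonempty with h | ⟨e, he, heC⟩
  · obtain ⟨e, he⟩ := boundary_nonempty hB hne
    obtain ⟨F, h1, h2, -⟩ := hex e he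
    exact ⟨F, h1, h2, h ▸ Set.empty_subset F⟩
  · obtain ⟨F, hF, hFB, heF⟩ := hex e he
    refine ⟨F, hF, hFB, ?_⟩
    rintro f ⟨hf, hfC⟩
    obtain ⟨F', hF', hFB', hfF'⟩ := hex f hf
    obtain ⟨A, hA, rfl⟩ := hC.exists_boundary_eq
    obtain ⟨A₁, hA₁, rfl⟩ := hF.exists_boundary_eq
    obtain ⟨A₂, hA₂, rfl⟩ := hF'.exists_boundary_eq
    have h := hmax A hA hCS
    have h1 := hmax A₁ hA₁ (hFB.trans hBS)
    have h2 := hmax A₂ hA₂ (hFB'.trans hBS)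
    -- The interior of `C` lies inside `F` and meets that of `F'`, so the interiors of `F` and `F'`
    -- meet and each contains the other.
    have h3 := hC.subset_of_inter_nonempty hA h hFB
      (inter_nonempty_of_mem_boundary h h1 heC heF he)
    obtain ⟨z, hz, hz'⟩ := inter_nonempty_of_mem_boundary h h2 hfC hfF' hf
    have h4 := hF.subset_of_inter_nonempty hA₁ h1 hFB' ⟨z, h3 hz, hz'⟩
    have h5 := hF'.subset_of_inter_nonempty hA₂ h2 hFB ⟨z, hz', h3 hz⟩
    rwa [h4.antisymm h5]

end Greatest

/-- The outer boundary of two cycles with two common vertices is a cycle. -/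
theorem IsCycle.isCycle_boundary_greatest {C D : Set (Sym2 (ℤ × ℤ))} {B : Set (ℤ × ℤ)}
    (hC : IsCycle C) (hD : IsCycle D) (h : (vertices C ∩ vertices D).Nontrivial)
    (hB : B.Finite) (hne : B.Nonempty) (hBS : boundary B ⊆ C ∪ D)
    (hmax : ∀ X : Set (ℤ × ℤ), X.Finite → boundary X ⊆ C ∪ D → X ⊆ B) :
    IsCycle (boundary B) := by
  have hS := hC.finite.union hD.finite
  obtain ⟨F, hF, hFB, hCF⟩ :=
    hC.exists_isCycle_inter_subset hB hne hBS hS hmax Set.subset_union_left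
  obtain ⟨F', hF', hFB', hDF'⟩ :=
    hD.exists_isCycle_inter_subset hB hne hBS hS hmax Set.subset_union_right
  by_cases heq : F = F'
  · subst heq
    have : boundary B = F := by
      refine Set.Subset.antisymm (fun e he => ?_) hFB
      rcases hBS he with h' | h'
      · exact hCF ⟨he, h'⟩
      · exact hDF' ⟨he, h'⟩
    rwa [this]
  · have hdisj : ∀ e ∈ F, e ∉ F' := fun e h1 h2 =>
      heq (hF.eq_of_mem hBS hmax hF' hFB hFB' h1 h2)
    obtain rfl : F = C := hC.eq_of_subset hF.isEven hF.nonempty fun e he =>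
      (hBS (hFB he)).resolve_right fun h' => hdisj e he (hDF' ⟨hFB he, h'⟩)
    obtain rfl : F' = D := hD.eq_of_subset hF'.isEven hF'.nonempty fun e he =>
      (hBS (hFB' he)).resolve_left fun h' => hdisj e (hCF ⟨hFB' he, h'⟩) he
    obtain ⟨Q, hQ, hQsub, ⟨e, heQ, heF⟩, hQF⟩ :=
      hF.exists_third_cycle hF' (Set.disjoint_left.2 hdisj) h
    exact absurd (hQ.eq_of_mem hBS hmax hF (hQsub.trans (Set.union_subset hFB hFB')) hFB heQ heF)
      hQF

/-- The outer boundary of two cycles is their only possible merger. -/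
theorem IsMerger.eq_boundary_greatest {C D E : Set (Sym2 (ℤ × ℤ))} {B : Set (ℤ × ℤ)}
    (hE : IsMerger C D E) (hB : B.Finite) (hBS : boundary B ⊆ C ∪ D)
    (hmax : ∀ X : Set (ℤ × ℤ), X.Finite → boundary X ⊆ C ∪ D → X ⊆ B) : E = boundary B := by
  obtain ⟨Y, hY, rfl⟩ := hE.isCycle.exists_boundary_eq
  have hYB := hmax Y hY hE.subset_union
  refine congrArg boundary (hYB.antisymm (Set.sdiff_eq_empty.1 ?_))
  by_contra hne
  -- A boundary edge of `B \ Y` has a square outside `Y`, so it is not inside the merger and must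
  -- belong to it; minimality then gives this absurd equality.
  have hX : B \ Y = Y := by
    refine hE.isCycle.eq_of_boundary_subset hY (hB.subset Set.sdiff_subset)
      (Set.nonempty_iff_ne_empty.2 hne) fun e he => ?_
    have heS : e ∈ C ∪ D :=
      (boundary_diff_subset B Y he).elim (fun h => hBS h) fun h => hE.subset_union h
    refine (hE.edge_mem_or_inside e heS).resolve_right fun h => ?_
    obtain ⟨z, hz, -, -, hez, -⟩ := he
    exact hz.2 (((edgeInside_iff hE.isCycle hY).1 h).2 z hez)
  obtain ⟨z, hz⟩ := Set.nonempty_iff_ne_empty.2 hne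
  exact hz.2 (hX ▸ hz)

theorem isMerger_boundary_greatest {A A' B : Set (ℤ × ℤ)}
    (hC : IsCycle (boundary A)) (hD : IsCycle (boundary A')) (hA : A.Finite) (hA' : A'.Finite)
    (hB : B.Finite) (hE : IsCycle (boundary B)) (hBS : boundary B ⊆ boundary A ∪ boundary A')
    (hAB : A ⊆ B) (hAB' : A' ⊆ B) : IsMerger (boundary A) (boundary A') (boundary B) where
  isCycle := hE
  subset_union := hBS
  inside_left := (inside_subset_inside_iff hC hA hE hB).2 hAB
  inside_right := (inside_subset_inside_iff hD hA' hE hB).2 hAB'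
  edge_mem_or_inside := by
    have key : ∀ X ⊆ B, ∀ e ∈ boundary X, e ∈ boundary B ∨ EdgeInside e (boundary B) := by
      rintro X hX e ⟨z, hz, -, -, hez, -⟩
      refine or_iff_not_imp_left.2 fun h => (edgeInside_iff hE hB).2 ⟨hez.1, fun w hw => ?_⟩
      by_contra hwB
      exact h ⟨z, hX hz, w, hwB, hez, hw⟩
    rintro e (he | he)
    · exact key A hAB e he
    · exact key A' hAB' e he

/-- If an edge of `D` lies in the exterior of `C`, then some edge of `D` in the merger of `C`
and `D` does. -/
theorem IsMerger.exists_edgeOutside {C D E : Set (Sym2 (ℤ × ℤ))} (hE : IsMerger C D E)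
    (hC : IsCycle C) (h : ∃ e ∈ D, EdgeOutside e C) : ∃ e ∈ E, e ∈ D ∧ EdgeOutside e C := by
  obtain ⟨A, hA, rfl⟩ := hC.exists_boundary_eq
  obtain ⟨Y, hY, rfl⟩ := hE.isCycle.exists_boundary_eq
  have hAY := (inside_subset_inside_iff hC hA hE.isCycle hY).1 hE.inside_left
  by_contra! hc
  -- An edge of `D` here that is not exterior to `C` has a square in `A`; it also has one outside `Y
  -- ⊇ A`, so it lies on `C`. The merger is then `C` itself, leaving no place for an edge of `D`
  -- exterior to `C`.
  have hsub : boundary Y ⊆ boundary A := by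
    intro e he
    rcases hE.subset_union he with h' | h'
    · exact h'
    · have hno := hc e he h'
      rw [edgeOutside_iff hC hA] at hno
      push Not at hno
      obtain ⟨z, hez, hz⟩ := hno (boundary_subset_edgeSet Y he)
      obtain ⟨-, -, w, hw, -, hew⟩ := he
      exact ⟨z, hz, w, fun h => hw (hAY h), hez, hew⟩
  obtain ⟨e, heD, heo⟩ := h
  rw [edgeOutside_iff hC hA] at heo
  have hEC := hC.eq_of_subset hE.isCycle.isEven hE.isCycle.nonempty hsub
  rcases hE.edge_mem_or_inside e (Or.inr heD) with h | h
  · obtain ⟨z, hz, -, -, hez, -⟩ := hsub h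
    exact heo.2 z hez hz
  · rw [hEC, edgeInside_iff hC hA] at h
    rcases edge_cases heo.1 with ⟨x, y, rfl⟩ | ⟨x, y, rfl⟩
    · have hz := isEdgeOfSquare_hEdge.2 (Or.inl (Eq.refl (x, y)))
      exact heo.2 _ hz (h.2 _ hz)
    · have hz := isEdgeOfSquare_vEdge.2 (Or.inl (Eq.refl (x, y)))
      exact heo.2 _ hz (h.2 _ hz)

end SquareGrid

theorem theorem3 (C D : Set (Sym2 (ℤ × ℤ)))
    (hC : SquareGrid.IsCycle C) (hD : SquareGrid.IsCycle D)
    (hCD : (SquareGrid.vertices C ∩ SquareGrid.vertices D).Nontrivial) :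
    (∃! E : Set (Sym2 (ℤ × ℤ)), SquareGrid.IsMerger C D E) ∧
      ∀ E : Set (Sym2 (ℤ × ℤ)), SquareGrid.IsMerger C D E →
        (∃ e ∈ D, SquareGrid.EdgeOutside e C) →
          ∃ e ∈ E, e ∈ D ∧ SquareGrid.EdgeOutside e C := by
  refine ⟨?_, fun E hE h => hE.exists_edgeOutside hC h⟩
  obtain ⟨B, hB, hBS, hmax⟩ :=
    SquareGrid.exists_greatest_boundary_subset (hC.finite.union hD.finite)
  refine ⟨SquareGrid.boundary B, ?_, fun E hE => hE.eq_boundary_greatest hB hBS hmax⟩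
  obtain ⟨A, hA, rfl⟩ := hC.exists_boundary_eq
  obtain ⟨A', hA', rfl⟩ := hD.exists_boundary_eq
  have hAB := hmax A hA Set.subset_union_left
  have hAB' := hmax A' hA' Set.subset_union_right
  have hne : B.Nonempty := by
    obtain ⟨_, z, hz, -⟩ := hC.nonempty
    exact ⟨z, hAB hz⟩
  exact SquareGrid.isMerger_boundary_greatest hC hD hA hA' hB
    (hC.isCycle_boundary_greatest hD hCD hB hne hBS hmax) hBS hAB hAB'
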